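/- Let $(X,d)$ be an infinite compact metric space and $f:X\to X$ a continuous map. The following three conditions are equivalent. 1. $(X,f)$ has the gluing orbit property and zero topological entropy. 2. $(X,f)$ is minimal (the forward orbit $\{f^n(x):n\ge 0\}$ of every $x\in X$ is dense in $X$) and equicontinuous (for every $\varepsilon>0$ there is $\delta>0$ such that $d(x,y)<\delta$ implies $d(f^n(x),f^n(y))<\varepsilon$ for all $n\ge 0$). 3. $(X,f)$ is topologically conjugate to a minimal rotation on a compact abelian group: there are a compact Hausdorff abelian topological group $G$, an element $a\in G$ for which $R_a:g\mapsto ag$ is minimal, and a homeomorphism $h:X\to G$ with $h\circ f=R_a\circ h$. Here $(X,f)$ has the *gluing orbit property* if for every $\varepsilon>0$ there is an integer $M\ge 1$ such that for every sequence $(x_j,m_j)_{j\ge 1}$ of points $x_j\in X$ and integers $m_j\ge 1$ there are integers $t_j\in\{1,\dots,M\}$ ($j\ge1$) and a point $z\in X$ with $$d\bigl(f^{s_j+l}(z),f^l(x_j)\bigr)\le\varepsilon\quad\text{for all } j\ge 1 \text{ and } 0\le l\le m_j-1,\qquad\text{where } s_j=\sum_{i=1}^{j-1}(m_i+t_i-1).$$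 The *topological entropy* of $(X,f)$ is $$h(f)=\lim_{\varepsilon\to0}\limsup_{n\to\infty}\frac{\ln s(X,n,\varepsilon)}{n},$$ where $s(X,n,\varepsilon)$ is the maximal cardinality of a set $E\subset X$ such that any two distinct $x,y\in E$ satisfy $d(f^k(x),f^k(y))>\varepsilon$ for some $0\le k\le n-1$. -/

import Mathlib

universe u

namespace TopDyn

variable {X : Type*}

/-- The starting times `s_j = ∑_{i < j} (m_i + t_i - 1)` of the successive orbit segments of lengths
`m_i` with gaps `t_i`. Sequences are indexed by `ℕ`, starting from `0`. -/
def startTime (m t : ℕ → ℕ) (j : ℕ) : ℕ := ∑ i ∈ Finset.range j, (m i + t i - 1)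

/-- The orbit sequence `(x_j, m_j)` with gap `t` is `ε`-traced by the point `z` under `f`. -/
def IsTracedBy [PseudoMetricSpace X] (f : X → X) (ε : ℝ) (x : ℕ → X) (m t : ℕ → ℕ) (z : X) : Prop :=
  ∀ j : ℕ, ∀ l < m j, dist (f^[startTime m t j + l] z) (f^[l] (x j)) ≤ ε

/-- The gluing orbit property: for every `ε > 0` there is `M ≥ 1` such that every orbit sequence
`(x_j, m_j)` (with all `m_j ≥ 1`) is `ε`-traced by some point, with a gap in `{1, …, M}^ℕ`. -/
def GluingOrbitProperty [PseudoMetricSpace X] (f : X → X) : Prop :=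
  ∀ ε : ℝ, 0 < ε → ∃ M : ℕ, 0 < M ∧
    ∀ (x : ℕ → X) (m : ℕ → ℕ), (∀ j, 1 ≤ m j) →
      ∃ t : ℕ → ℕ, (∀ j, 1 ≤ t j ∧ t j ≤ M) ∧ ∃ z : X, IsTracedBy f ε x m t z

/-- `E` is `(n, ε)`-separated for `f`. -/
def IsSeparatedSet [PseudoMetricSpace X] (f : X → X) (n : ℕ) (ε : ℝ) (E : Set X) : Prop :=
  ∀ x ∈ E, ∀ y ∈ E, x ≠ y → ∃ k < n, ε < dist (f^[k] x) (f^[k] y)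

/-- The maximal cardinality `s(X, n, ε)` of an `(n, ε)`-separated subset of the whole space. -/
noncomputable def sepCard [PseudoMetricSpace X] (f : X → X) (n : ℕ) (ε : ℝ) : ℕ∞ :=
  ⨆ (E : Finset X) (_ : IsSeparatedSet f n ε (E : Set X)), (E.card : ℕ∞)

/-- The `ε`-entropy `limsup_{n → ∞} (ln s(X, n, ε)) / n`, in `[-∞, ∞]`. -/
noncomputable def epsEntropy [PseudoMetricSpace X] (f : X → X) (ε : ℝ) : EReal :=
  Filter.limsup (fun n : ℕ => ENNReal.log ((sepCard f n ε : ℕ∞) : ENNReal) / (n : EReal))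
    Filter.atTop

/-- The topological entropy of `f`: the limit of the `ε`-entropies as `ε → 0`, which is their
supremum because the `ε`-entropy increases as `ε` decreases. -/
noncomputable def topEntropy [PseudoMetricSpace X] (f : X → X) : EReal :=
  ⨆ (ε : ℝ) (_ : 0 < ε), epsEntropy f ε

/-- `f` is minimal: every forward orbit is dense. -/
def IsMinimalMap [TopologicalSpace X] (f : X → X) : Prop :=
  ∀ x : X, Dense (Set.range fun n : ℕ => f^[n] x)

/-- The family of the iterates `f^n`, `n ≥ 0`, is (uniformly) equicontinuous: for every `ε > 0`
there is `δ > 0` such that `d(x, y) < δ` implies `d(f^n x, f^n y) < ε` for all `n`. -/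
def IsEquicontinuousMap [UniformSpace X] (f : X → X) : Prop :=
  UniformEquicontinuous fun n : ℕ => f^[n]

/-- `f` is topologically conjugate to a minimal rotation `g ↦ a * g` on a compact (Hausdorff)
abelian topological group. Such a group is homeomorphic to `X`, so nothing is lost by looking for
it in the universe of `X`. -/
def IsConjToMinimalRotation {X : Type u} [TopologicalSpace X] (f : X → X) : Prop :=
  ∃ (G : Type u) (_ : CommGroup G) (_ : TopologicalSpace G) (_ : IsTopologicalGroup G)
    (_ : CompactSpace G) (_ : T2Space G) (a : G) (h : X ≃ₜ G),
    IsMinimalMap (fun g : G => a * g) ∧ ∀ x : X, h (f x) = a * h x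

end TopDyn

/-! Zero entropy turns gluing into equicontinuity by counting. If more than `M` points are `(n,
ε)`-separated, `M` being the gap bound at scale `ε / 3`, glue words of length `k` in them: words
with equal gaps give separated tracing points, and there are at most `M ^ k` gap patterns, so the
entropy is positive. Hence separated sets are bounded in size for all `n` at once, which yields a
finite net valid for all time and so equicontinuity (`equicontinuous_iterate_of_card_le`). Gluing
`x` to `y` then gives minimality. Conversely, equicontinuity bounds separated sets, and one dense
orbit traces everything because its errors never grow. The group law extends `f^n x₀ * f^m x₀ =
f^(n+m) x₀` by uniform continuity. -/

namespace TopDyn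

/-! ### Counting separated orbit segments -/

section Separated

variable {X : Type*} [PseudoMetricSpace X] {f : X → X}

theorem IsSeparatedSet.card_le_sepCard {n : ℕ} {ε : ℝ} {E : Finset X}
    (hE : IsSeparatedSet f n ε (E : Set X)) : (E.card : ℕ∞) ≤ sepCard f n ε :=
  le_iSup₂_of_le E hE le_rfl

theorem one_le_sepCard [Nonempty X] (n : ℕ) (ε : ℝ) : 1 ≤ sepCard f n ε := by
  obtain ⟨x⟩ := ‹Nonempty X›
  have hE : IsSeparatedSet f n ε (({x} : Finset X) : Set X) := by
    intro a ha b hb hab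
    simp only [Finset.coe_singleton, Set.mem_singleton_iff] at ha hb
    exact absurd (ha.trans hb.symm) hab
  simpa using hE.card_le_sepCard

theorem startTime_congr {m t t' : ℕ → ℕ} {j : ℕ} (h : ∀ i < j, t i = t' i) :
    startTime m t j = startTime m t' j :=
  Finset.sum_congr rfl fun i hi => by rw [h i (Finset.mem_range.1 hi)]

theorem startTime_const_le {n M : ℕ} {t : ℕ → ℕ} (ht : ∀ i, t i ≤ M) (j : ℕ) :
    startTime (fun _ => n) t j ≤ j * (n + M) := by
  refine (Finset.sum_le_card_nsmul _ _ (n + M) fun i _ => ?_).trans_eq (by simp)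
  have := ht i
  dsimp only
  omega

/-- Gluing `k` segments chosen from a separated set `E` gives `E.card ^ k` points; those with the
same gaps are separated from each other. -/
theorem card_pow_le_mul_sepCard [Nonempty X] {ε : ℝ} {M n : ℕ} (hn : 1 ≤ n)
    (hM : ∀ (x : ℕ → X) (m : ℕ → ℕ), (∀ j, 1 ≤ m j) →
      ∃ t : ℕ → ℕ, (∀ j, 1 ≤ t j ∧ t j ≤ M) ∧ ∃ z : X, IsTracedBy f ε x m t z)
    {E : Finset X} (hE : IsSeparatedSet f n (3 * ε) (E : Set X)) (k : ℕ) :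
    ((E.card ^ k : ℕ) : ℕ∞) ≤ (M ^ k : ℕ) * sepCard f (k * (n + M)) ε := by
  classical
  rcases Nat.eq_zero_or_pos M with rfl | hMpos
  · obtain ⟨t, ht, -⟩ := hM (fun _ => Classical.arbitrary X) (fun _ => 1) (fun _ => le_rfl)
    have := ht 0
    omega
  by_cases htop : sepCard f (k * (n + M)) ε = ⊤
  · rw [htop, ENat.mul_top (by exact_mod_cast (pow_pos hMpos k).ne')]
    exact le_top
  obtain ⟨S, hS⟩ := ENat.ne_top_iff_exists.1 htop
  let x : (Fin k → E) → ℕ → X := fun w j =>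
    if h : j < k then (w ⟨j, h⟩ : X) else Classical.arbitrary X
  choose t ht z hz using fun w => hM (x w) (fun _ => n) (fun _ => hn)
  let g : (Fin k → E) → Fin k → Finset.Icc 1 M := fun w i => ⟨t w i, Finset.mem_Icc.2 (ht w i)⟩
  have key : ∀ w w', g w = g w' → w ≠ w' →
      ∃ p < k * (n + M), ε < dist (f^[p] (z w)) (f^[p] (z w')) := by
    intro w w' hg hw
    obtain ⟨i, hi⟩ := Function.ne_iff.1 hw
    obtain ⟨l, hl, hd⟩ := hE (w i) (w i).2 (w' i) (w' i).2 (fun h => hi (Subtype.ext h))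
    have hs : startTime (fun _ => n) (t w) i = startTime (fun _ => n) (t w') i := by
      refine startTime_congr fun j hj => ?_
      exact congrArg Subtype.val (congrFun hg ⟨j, hj.trans i.2⟩)
    refine ⟨startTime (fun _ => n) (t w) i + l, ?_, ?_⟩
    · have h1 := startTime_const_le (n := n) (fun j => (ht w j).2) i
      have h2 : ((i : ℕ) + 1) * (n + M) ≤ k * (n + M) := Nat.mul_le_mul_right _ i.2
      rw [add_mul, one_mul] at h2
      omega
    · have h1 := hz w i l hl
      have h2 := hz w' i l hl
      rw [← hs] at h2
      simp only [x, i.2, dif_pos, Fin.eta] at h1 h2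
      -- Of the separation `3 * ε`, each of the two tracings costs at most `ε`.
      have h3 := dist_triangle4 (f^[l] (w i)) (f^[startTime (fun _ => n) (t w) i + l] (z w))
        (f^[startTime (fun _ => n) (t w) i + l] (z w')) (f^[l] (w' i))
      rw [dist_comm (f^[l] (w i : X)) (f^[_] (z w))] at h3
      have h4 : 0 ≤ ε := dist_nonneg.trans h1
      linarith
  have hε : 0 ≤ ε := dist_nonneg.trans
    ((hM (fun _ => Classical.arbitrary X) (fun _ => 1) (fun _ => le_rfl)).choose_spec.2.choose_spec
      0 0 one_pos)
  have hfib : ∀ c : Fin k → Finset.Icc 1 M, (Finset.univ.filter fun w => g w = c).card ≤ S := by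
    intro c
    have hinj : Set.InjOn z ((Finset.univ.filter fun w => g w = c : Finset _) : Set _) := by
      intro w hw w' hw' h
      simp only [Finset.coe_filter, Finset.mem_univ, true_and, Set.mem_ofPred_eq] at hw hw'
      by_contra hne
      obtain ⟨p, -, hp⟩ := key w w' (hw.trans hw'.symm) hne
      rw [h, dist_self] at hp
      linarith
    rw [← Finset.card_image_of_injOn hinj]
    have hsep : IsSeparatedSet f (k * (n + M)) ε
        (((Finset.univ.filter fun w => g w = c).image z : Finset X) : Set X) := by
      intro a ha b hb hab
      simp only [Finset.coe_image, Finset.coe_filter, Finset.mem_univ, true_and, Set.mem_image,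
        Set.mem_ofPred_eq] at ha hb
      obtain ⟨w, hw, rfl⟩ := ha
      obtain ⟨w', hw', rfl⟩ := hb
      exact key w w' (hw.trans hw'.symm) (fun h => hab (congrArg z h))
    have := hsep.card_le_sepCard
    rw [← hS] at this
    exact_mod_cast this
  have hcount := Finset.card_le_mul_card_image_of_maps_to (f := g) (s := Finset.univ)
    (t := Finset.univ) (fun _ _ => Finset.mem_univ _) S (fun c _ => hfib c)
  simp only [Finset.card_univ, Fintype.card_fun, Fintype.card_coe, Fintype.card_fin, Nat.card_Icc,
    Nat.add_sub_cancel] at hcount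
  rw [← hS, mul_comm]
  exact_mod_cast hcount

theorem epsEntropy_pos_of_pow_le {ε : ℝ} {M N K : ℕ} (hM : 0 < M) (hN : 0 < N) (hK : M < K)
    (h : ∀ k : ℕ, ((K ^ k : ℕ) : ℕ∞) ≤ (M ^ k : ℕ) * sepCard f (k * N) ε) :
    0 < epsEntropy f ε := by
  have hM' : (0 : ℝ) < M := by exact_mod_cast hM
  have hN' : (0 : ℝ) < N := by exact_mod_cast hN
  have hr : (1 : ℝ) < K / M := by
    rw [one_lt_div hM']
    exact_mod_cast hK
  have hc : 0 < Real.log (K / M) := Real.log_pos hr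
  have hpow : ∀ k : ℕ, ENNReal.ofReal ((K : ℝ) / M) ^ k ≤
      ((sepCard f (k * N) ε : ℕ∞) : ENNReal) := by
    intro k
    have h1 : ((K : ENNReal)) ^ k ≤ (M : ENNReal) ^ k * ((sepCard f (k * N) ε : ℕ∞) : ENNReal) := by
      have := ENat.toENNReal_le.2 (h k)
      rw [ENat.toENNReal_mul] at this
      simpa using this
    rw [ENNReal.ofReal_div_of_pos hM', ENNReal.ofReal_natCast, ENNReal.ofReal_natCast,
      div_eq_mul_inv, mul_pow, ← ENNReal.inv_pow, ← div_eq_mul_inv]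
    exact ENNReal.div_le_of_le_mul' h1
  have hle : ∀ k : ℕ, 1 ≤ k → ((Real.log (K / M) / N : ℝ) : EReal) ≤
      ENNReal.log ((sepCard f (k * N) ε : ℕ∞) : ENNReal) / ((k * N : ℕ) : EReal) := by
    intro k hk
    have hk' : (0 : ℝ) < k := by exact_mod_cast hk
    have h2 := ENNReal.log_monotone (hpow k)
    rw [ENNReal.log_pow, ENNReal.log_ofReal_of_pos (zero_lt_one.trans hr)] at h2
    have h3 := EReal.div_le_div_right_of_nonneg (c := ((k * N : ℕ) : EReal)) (by positivity) h2
    refine le_trans (le_of_eq ?_) h3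
    have : (((k * N : ℕ) : EReal)) = (((k * N : ℝ)) : EReal) := by push_cast; rfl
    rw [this]
    have h4 : ((k : EReal) * ((Real.log (K / M) : ℝ) : EReal)) =
      ((k * Real.log (K / M) : ℝ) : EReal) := by push_cast; rfl
    rw [h4, ← EReal.coe_div, EReal.coe_eq_coe_iff]
    field_simp
  refine lt_of_lt_of_le (b := ((Real.log (K / M) / N : ℝ) : EReal)) ?_ ?_
  · exact_mod_cast div_pos hc hN'
  -- For a limsup, the bound along multiples of `N` is enough.
  · refine Filter.le_limsup_of_frequently_le' (Filter.frequently_atTop.2 fun a => ?_)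
    exact ⟨(a + 1) * N, by nlinarith, hle (a + 1) (by omega)⟩

/-- Under the gluing orbit property, zero entropy bounds the number of separated orbit segments
independently of their length. -/
theorem GluingOrbitProperty.exists_card_le_of_topEntropy_eq_zero [Nonempty X]
    (hg : GluingOrbitProperty f) (h0 : topEntropy f = 0) {ε : ℝ} (hε : 0 < ε) :
    ∃ C : ℕ, ∀ (n : ℕ) (E : Finset X), IsSeparatedSet f n ε (E : Set X) → E.card ≤ C := by
  obtain ⟨M, hM, hglue⟩ := hg (ε / 3) (by positivity)
  refine ⟨M, fun n E hE => ?_⟩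
  by_contra! hcard
  have hn : 1 ≤ n := by
    obtain ⟨a, ha, b, hb, hab⟩ := Finset.one_lt_card.1 (lt_of_le_of_lt hM hcard)
    obtain ⟨k, hk, -⟩ := hE a ha b hb hab
    omega
  rw [show ε = 3 * (ε / 3) by ring] at hE
  have hpos : 0 < epsEntropy f (ε / 3) :=
    epsEntropy_pos_of_pow_le hM (by omega : 0 < n + M) hcard
      (card_pow_le_mul_sepCard hn hglue hE)
  have hle : epsEntropy f (ε / 3) ≤ topEntropy f :=
    le_iSup₂_of_le (ε / 3) (by positivity) le_rfl
  rw [h0] at hle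
  exact absurd hpos hle.not_gt

end Separated

/-! ### Bounded separation and equicontinuity -/

section Equicontinuity

variable {X : Type*} [PseudoMetricSpace X] {f : X → X}

/-- A bound on separated sets gives a finite net for the metric `sup_k d (f^k x) (f^k y)`. -/
theorem exists_finset_forall_dist_iterate_le {ε : ℝ} (hε : 0 ≤ ε) {C : ℕ}
    (hC : ∀ (n : ℕ) (E : Finset X), IsSeparatedSet f n ε (E : Set X) → E.card ≤ C) :
    ∃ E : Finset X, ∀ y, ∃ e ∈ E, ∀ k, dist (f^[k] y) (f^[k] e) ≤ ε := by
  classical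
  let S : Set ℕ := {c | ∃ (n : ℕ) (E : Finset X), IsSeparatedSet f n ε (E : Set X) ∧ E.card = c}
  have hbdd : BddAbove S := ⟨C, by rintro _ ⟨n, E, hE, rfl⟩; exact hC n E hE⟩
  have hne : S.Nonempty := ⟨0, 0, ∅, by simp [IsSeparatedSet], rfl⟩
  -- `E` is largest over all lengths: a point escaping every `e ∈ E` could be added after
  -- lengthening `n` past the finitely many escape times.
  obtain ⟨n, E, hE, hcard⟩ := Nat.sSup_mem hne hbdd
  refine ⟨E, fun y => ?_⟩
  by_contra! hy
  have hyE : y ∉ E := fun h => by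
    obtain ⟨k, hk⟩ := hy y h
    rw [dist_self] at hk
    linarith
  choose! k hk using hy
  have hins : IsSeparatedSet f (max n (E.sup k + 1)) ε ((insert y E : Finset X) : Set X) := by
    have hlt : ∀ e ∈ E, k e < max n (E.sup k + 1) := fun e he =>
      lt_max_of_lt_right (Nat.lt_succ_of_le (Finset.le_sup he))
    intro a ha b hb hab
    rw [Finset.coe_insert] at ha hb
    rcases ha with rfl | ha <;> rcases hb with rfl | hb
    · exact absurd rfl hab
    · exact ⟨k b, hlt b hb, hk b hb⟩
    · exact ⟨k a, hlt a ha, by rw [dist_comm]; exact hk a ha⟩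
    · obtain ⟨l, hl, hd⟩ := hE a ha b hb hab
      exact ⟨l, lt_max_of_lt_left hl, hd⟩
  have hle := le_csSup hbdd ⟨_, _, hins, rfl⟩
  rw [Finset.card_insert_of_notMem hyE, ← hcard] at hle
  omega

/-- The points shadowed for all time by a given net point form a closed set. So a net point
shadowing some `y` close enough to `x` also shadows `x`, and the orbits of `x` and `y` stay close.
-/
theorem equicontinuous_iterate_of_card_le (hf : Continuous f)
    (h : ∀ ε : ℝ, 0 < ε → ∃ C : ℕ, ∀ (n : ℕ) (E : Finset X),
      IsSeparatedSet f n ε (E : Set X) → E.card ≤ C) :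
    Equicontinuous fun n : ℕ => f^[n] := by
  intro x
  rw [Metric.equicontinuousAt_iff_right]
  intro ε hε
  obtain ⟨C, hC⟩ := h (ε / 3) (by positivity)
  obtain ⟨E, hE⟩ := exists_finset_forall_dist_iterate_le (by positivity) hC
  have hev : ∀ᶠ y in nhds x, ∀ e ∈ E, (∀ k, dist (f^[k] y) (f^[k] e) ≤ ε / 3) →
      ∀ k, dist (f^[k] x) (f^[k] e) ≤ ε / 3 := by
    rw [Filter.eventually_all_finset]
    intro e _
    have hcl : IsClosed {y | ∀ k, dist (f^[k] y) (f^[k] e) ≤ ε / 3} := by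
      simp only [Set.ofPred_forall]
      exact isClosed_iInter fun k =>
        isClosed_le ((hf.iterate k).dist continuous_const) continuous_const
    by_cases hx : ∀ k, dist (f^[k] x) (f^[k] e) ≤ ε / 3
    · exact Filter.Eventually.of_forall fun _ _ => hx
    · filter_upwards [hcl.isOpen_compl.mem_nhds hx] with y hy hy'
      exact absurd hy' hy
  filter_upwards [hev] with y hy i
  obtain ⟨e, he, hye⟩ := hE y
  have h1 := hy e he hye i
  have h2 := hye i
  have h3 := dist_triangle_right (f^[i] x) (f^[i] y) (f^[i] e)
  linarith

/-- Two points in one ball of radius `δ / 2` are never separated, so a finite cover bounds the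
count. -/
theorem IsEquicontinuousMap.exists_card_le [CompactSpace X] (h : IsEquicontinuousMap f) {ε : ℝ}
    (hε : 0 < ε) :
    ∃ C : ℕ, ∀ (n : ℕ) (E : Finset X), IsSeparatedSet f n ε (E : Set X) → E.card ≤ C := by
  classical
  obtain ⟨δ, hδ, hδε⟩ := Metric.uniformEquicontinuous_iff.1 h ε hε
  obtain ⟨T, -, hTfin, hT⟩ :=
    (isCompact_univ (X := X)).finite_cover_balls (half_pos hδ)
  refine ⟨hTfin.toFinset.card, fun n E hE => ?_⟩
  have hc : ∀ x : X, ∃ c ∈ T, dist x c < δ / 2 := fun x => by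
    simpa using hT (Set.mem_univ x)
  choose c hcT hc using hc
  refine Finset.card_le_card_of_injOn c (fun x _ => by simpa using hcT x) ?_
  intro x hx y hy hxy
  by_contra hne
  obtain ⟨k, -, hk⟩ := hE x hx y hy hne
  have h1 := hc x
  have h2 := hc y
  rw [← hxy] at h2
  have h3 := hδε x y (by linarith [dist_triangle_right x y (c x)]) k
  linarith

theorem IsEquicontinuousMap.topEntropy_eq_zero [CompactSpace X] [Nonempty X]
    (h : IsEquicontinuousMap f) : topEntropy f = 0 := by
  apply le_antisymm
  · refine iSup₂_le fun ε hε => ?_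
    obtain ⟨C, hC⟩ := h.exists_card_le hε
    have hs : ∀ n, ENNReal.log ((sepCard f n ε : ℕ∞) : ENNReal) ≤
        ((Real.log (C + 1) : ℝ) : EReal) := by
      intro n
      have h1 : sepCard f n ε ≤ ((C + 1 : ℕ) : ℕ∞) := iSup₂_le fun E hE => by
        exact_mod_cast (hC n E hE).trans (Nat.le_succ C)
      have h2 := ENat.toENNReal_le.2 h1
      rw [ENat.toENNReal_coe] at h2
      have h3 := ENNReal.log_monotone h2
      rwa [← ENNReal.ofReal_natCast, ENNReal.log_ofReal_of_pos (by positivity), Nat.cast_succ]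
        at h3
    have hlim : Filter.Tendsto (fun n : ℕ => ((Real.log (C + 1) / n : ℝ) : EReal)) Filter.atTop
        (nhds 0) :=
      (continuous_coe_real_ereal.tendsto 0).comp (tendsto_const_div_atTop_nhds_zero_nat _)
    rw [← hlim.limsup_eq]
    refine Filter.limsup_le_limsup (Filter.Eventually.of_forall fun n => ?_)
    exact EReal.div_le_div_right_of_nonneg (by positivity) (hs n)
  · refine le_iSup₂_of_le 1 one_pos (Filter.le_limsup_of_frequently_le' ?_)
    refine Filter.Frequently.of_forall fun n => ?_
    refine EReal.div_nonneg ?_ (by positivity)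
    rw [ENNReal.zero_le_log_iff]
    exact_mod_cast ENat.toENNReal_le.2 (one_le_sepCard (f := f) n 1)

end Equicontinuity

/-! ### Minimality and gluing -/

section Minimality

variable {X : Type*} [PseudoMetricSpace X] {f : X → X}

theorem GluingOrbitProperty.isMinimalMap (hg : GluingOrbitProperty f)
    (he : IsEquicontinuousMap f) : IsMinimalMap f := by
  intro x
  rw [Metric.dense_iff]
  intro y ε hε
  obtain ⟨δ, hδ, hδε⟩ := Metric.uniformEquicontinuous_iff.1 he (ε / 2) (by positivity)
  -- Error `δ / 2` at `x` lets the orbit of `x` follow that of `z`; error `ε / 3` at `y` leaves room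
  -- for the `ε / 2` so lost.
  obtain ⟨M, -, hM⟩ := hg (min (δ / 2) (ε / 3)) (by positivity)
  obtain ⟨t, -, z, hz⟩ := hM (fun j => if j = 0 then x else y) (fun _ => 1) (fun _ => le_rfl)
  have h0 := (hz 0 0 one_pos).trans (min_le_left _ _)
  have h1 := (hz 1 0 one_pos).trans (min_le_right _ _)
  simp only [startTime, Finset.range_zero, Finset.sum_empty, add_zero, Function.iterate_zero,
    id_eq, if_true, one_ne_zero, if_false] at h0 h1
  refine ⟨_, ?_, Set.mem_range_self (∑ i ∈ Finset.range 1, (1 + t i - 1))⟩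
  have h2 := hδε z x (by linarith) (∑ i ∈ Finset.range 1, (1 + t i - 1))
  rw [Metric.mem_ball]
  rw [dist_comm] at h2
  linarith [dist_triangle (f^[∑ i ∈ Finset.range 1, (1 + t i - 1)] x)
    (f^[∑ i ∈ Finset.range 1, (1 + t i - 1)] z) y]

/-- A minimal system on a compact space visits every ball within a uniformly bounded time. -/
theorem IsMinimalMap.exists_forall_exists_le_dist_lt [CompactSpace X] (hf : Continuous f)
    (h : IsMinimalMap f) {ε : ℝ} (hε : 0 < ε) :
    ∃ M : ℕ, ∀ x y : X, ∃ k ≤ M, dist (f^[k] x) y < ε := by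
  obtain ⟨M, hM⟩ := (isCompact_univ (X := X × X)).elim_directed_cover
    (fun M : ℕ => {p : X × X | ∃ k ≤ M, dist (f^[k] p.1) p.2 < ε})
    (fun M => by
      have : {p : X × X | ∃ k ≤ M, dist (f^[k] p.1) p.2 < ε} =
          ⋃ k, ⋃ (_ : k ≤ M), {p : X × X | dist (f^[k] p.1) p.2 < ε} := by
        ext; simp
      rw [this]
      exact isOpen_iUnion fun k => isOpen_iUnion fun _ =>
        isOpen_lt (((hf.iterate k).comp continuous_fst).dist continuous_snd) continuous_const)
    (fun p _ => by
      obtain ⟨_, hw, k, rfl⟩ := Metric.dense_iff.1 (h p.1) p.2 ε hε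
      exact Set.mem_iUnion.2 ⟨k, k, le_rfl, hw⟩)
    (directed_of_isDirected_le fun a b hab p ⟨k, hk, hp⟩ => ⟨k, hk.trans hab, hp⟩)
  exact ⟨M, fun x y => hM (Set.mem_univ (x, y))⟩

theorem IsMinimalMap.gluingOrbitProperty [CompactSpace X] (hf : Continuous f)
    (h : IsMinimalMap f) (he : IsEquicontinuousMap f) : GluingOrbitProperty f := by
  intro ε hε
  obtain ⟨δ, hδ, hδε⟩ := Metric.uniformEquicontinuous_iff.1 he ε hε
  obtain ⟨M, hM⟩ := h.exists_forall_exists_le_dist_lt hf hδ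
  refine ⟨M + 1, M.succ_pos, fun x m hm => ?_⟩
  choose τ hτM hτ using hM
  let s : ℕ → ℕ := fun j => Nat.rec 0 (fun i si => si + m i + τ (f^[si + m i] (x 0)) (x (i + 1))) j
  let t : ℕ → ℕ := fun i => τ (f^[s i + m i] (x 0)) (x (i + 1)) + 1
  have hs : ∀ j, startTime m t j = s j := by
    intro j
    induction j with
    | zero => rfl
    | succ j ih =>
      have h1 : startTime m t (j + 1) = startTime m t j + (m j + t j - 1) :=
        Finset.sum_range_succ _ _
      have h2 : s (j + 1) = s j + m j + τ (f^[s j + m j] (x 0)) (x (j + 1)) := rfl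
      rw [h1, h2, ih]
      simp only [t]
      omega
  refine ⟨t, fun j => ⟨Nat.succ_pos _, Nat.succ_le_succ (hτM _ _)⟩, x 0, fun j l _ => ?_⟩
  have hclose : dist (f^[s j] (x 0)) (x j) < δ := by
    cases j with
    | zero => simpa [s] using hδ
    | succ j =>
      have h2 : s (j + 1) = τ (f^[s j + m j] (x 0)) (x (j + 1)) + (s j + m j) := add_comm _ _
      rw [h2, Function.iterate_add_apply]
      exact hτ _ _
  rw [hs, add_comm, Function.iterate_add_apply]
  exact (hδε _ _ hclose l).le

end Minimality

/-! ### Group structure and rotations -/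

section Conjugacy

/-- On a compact Hausdorff abelian group with continuous multiplication, inversion is continuous. -/
theorem continuous_inv_of_compactSpace {G : Type*} [CommGroup G] [TopologicalSpace G]
    [CompactSpace G] [T2Space G] (hmul : Continuous fun p : G × G => p.1 * p.2) :
    Continuous fun g : G => g⁻¹ := by
  -- The shear `(g, h) ↦ (g, g * h)` is a continuous bijection of a compact Hausdorff space, and its
  -- inverse sends `(g, 1)` to `(g, g⁻¹)`.
  have hc : Continuous (Equiv.prodShear (Equiv.refl G) (Equiv.mulLeft : G → Equiv.Perm G)) :=
    continuous_fst.prodMk hmul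
  have h1 : Continuous fun g : G =>
      (hc.homeoOfEquivCompactToT2).symm (g, 1) :=
    (Homeomorph.continuous _).comp (continuous_id.prodMk continuous_const)
  refine (continuous_snd.comp h1).congr fun g => ?_
  change g⁻¹ * 1 = g⁻¹
  exact mul_one _

variable {X : Type*} [MetricSpace X] [CompactSpace X] {f : X → X}

/-- A uniformly continuous operation on a dense subset extends to the whole space. -/
theorem exists_continuous_extension_of_dense {N : Type*} {i : N → X} (hi : DenseRange i)
    (op : N → N → N)
    (hop : ∀ ε > 0, ∃ δ > 0, ∀ n m n' m', dist (i n) (i n') < δ → dist (i m) (i m') < δ →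
      dist (i (op n m)) (i (op n' m')) < ε) :
    ∃ μ : X → X → X, Continuous (fun p : X × X => μ p.1 p.2) ∧
      ∀ n m, μ (i n) (i m) = i (op n m) := by
  -- With the uniformity pulled back along `i`, `i` is uniformly inducing even when not injective.
  let _ : UniformSpace N := UniformSpace.comap i inferInstance
  have hi1 : IsUniformInducing i := ⟨rfl⟩
  have hi2 : IsUniformInducing (Prod.map i i) := hi1.prod hi1
  have hd2 : DenseRange (Prod.map i i) := hi.prodMap hi
  have hu : UniformContinuous fun p : N × N => i (op p.1 p.2) := by
    rw [(hi2.basis_uniformity Metric.uniformity_basis_dist).uniformContinuous_iff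
      Metric.uniformity_basis_dist]
    intro ε hε
    obtain ⟨δ, hδ, hδε⟩ := hop ε hε
    refine ⟨δ, hδ, ?_⟩
    rintro ⟨n, m⟩ ⟨n', m'⟩ hp
    have hp' : dist (i n, i m) (i n', i m') < δ := hp
    rw [Prod.dist_eq, max_lt_iff] at hp'
    exact hδε n m n' m' hp'.1 hp'.2
  refine ⟨fun x y => (hi2.isDenseInducing hd2).extend (fun p : N × N => i (op p.1 p.2)) (x, y),
    (uniformContinuous_uniformly_extend hi2 hd2 hu).continuous, fun n m => ?_⟩
  exact uniformly_extend_of_ind hi2 hd2 hu (n, m)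

/-- The addition `f^n x₀, f^m x₀ ↦ f^(n+m) x₀` on the orbit of `x₀` extends to the whole space. -/
theorem exists_continuous_mul_iterate (h : IsMinimalMap f) (he : IsEquicontinuousMap f) (x₀ : X) :
    ∃ μ : X → X → X, Continuous (fun p : X × X => μ p.1 p.2) ∧
      ∀ n m : ℕ, μ (f^[n] x₀) (f^[m] x₀) = f^[n + m] x₀ := by
  refine exists_continuous_extension_of_dense (h x₀) (· + ·) fun ε hε => ?_
  obtain ⟨δ, hδ, hδε⟩ := Metric.uniformEquicontinuous_iff.1 he (ε / 2) (by positivity)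
  refine ⟨δ, hδ, fun n m n' m' hn hm => ?_⟩
  -- Change one exponent at a time.
  have h1 := hδε _ _ hn m
  have h2 := hδε _ _ hm n'
  simp only [← Function.iterate_add_apply] at h1 h2
  rw [add_comm m n, add_comm m n'] at h1
  linarith [dist_triangle (f^[n + m] x₀) (f^[n' + m] x₀) (f^[n' + m'] x₀)]

/-- The group is `X` itself, with `f` as translation by `f x₀`. Identities pass from the orbit of
`x₀` to its closure. -/
theorem IsMinimalMap.isConjToMinimalRotation {X : Type u} [MetricSpace X] [CompactSpace X]
    [Nonempty X] {f : X → X} (hf : Continuous f) (h : IsMinimalMap f)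
    (he : IsEquicontinuousMap f) : IsConjToMinimalRotation f := by
  obtain ⟨x₀⟩ := ‹Nonempty X›
  obtain ⟨μ, hμ, hμi⟩ := exists_continuous_mul_iterate h he x₀
  have hd : DenseRange fun n : ℕ => f^[n] x₀ := h x₀
  have hμ' : ∀ {Y : Type u} [TopologicalSpace Y] {u v : Y → X}, Continuous u → Continuous v →
      Continuous fun y => μ (u y) (v y) := fun hu hv => hμ.comp (hu.prodMk hv)
  have hone : ∀ x, μ x₀ x = x := fun x =>
    hd.induction_on x (isClosed_eq (hμ' continuous_const continuous_id) continuous_id)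
      fun n => by simpa using hμi 0 n
  have hcomm : ∀ x y, μ x y = μ y x := fun x y =>
    hd.induction_on₂ (p := fun x y => μ x y = μ y x)
      (isClosed_eq hμ (hμ' continuous_snd continuous_fst))
      (fun n m => by rw [hμi, hμi, add_comm]) x y
  have hassoc : ∀ x y z, μ (μ x y) z = μ x (μ y z) := fun x y z =>
    hd.induction_on₃ (p := fun x y z => μ (μ x y) z = μ x (μ y z))
      (isClosed_eq
        (hμ' (hμ' continuous_fst (continuous_fst.comp continuous_snd))
          (continuous_snd.comp continuous_snd))
        (hμ' continuous_fst
          (hμ' (continuous_fst.comp continuous_snd) (continuous_snd.comp continuous_snd))))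
      (fun n m k => by rw [hμi, hμi, hμi, hμi, add_assoc]) x y z
  have hact : ∀ n x, μ (f^[n] x₀) x = f^[n] x := fun n x =>
    hd.induction_on x (isClosed_eq (hμ' continuous_const continuous_id) (hf.iterate n))
      fun m => by rw [hμi, Function.iterate_add_apply]
  have hsurj : Function.Surjective f := by
    have hcl : IsClosed (Set.range f) := (isCompact_range hf).isClosed
    have hden : Dense (Set.range f) := (h (f x₀)).mono (by
      rintro _ ⟨n, rfl⟩
      exact ⟨f^[n] x₀, (Function.iterate_succ_apply' f n x₀).symm⟩)
    rw [← Set.range_eq_univ, ← hcl.closure_eq, hden.closure_eq]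
  -- The forward orbit is only a semigroup. An `n`-th preimage of `x₀` inverts `f^[n] x₀`, and by
  -- compactness the invertible points form a closed set.
  have hinv : ∀ x, ∃ y, μ y x = x₀ := by
    have hcl : IsClosed {x | ∃ y, μ y x = x₀} := by
      have : {x | ∃ y, μ y x = x₀} = Prod.snd '' {p : X × X | μ p.1 p.2 = x₀} := by
        ext x; simp
      rw [this]
      exact isClosedMap_snd_of_compactSpace _ (isClosed_eq hμ continuous_const)
    intro x
    refine hd.induction_on x hcl fun n => ?_
    obtain ⟨y, hy⟩ := hsurj.iterate n x₀
    exact ⟨y, by rw [hcomm, hact, hy]⟩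
  choose ι hι using hinv
  let _ : Mul X := ⟨μ⟩
  let _ : Inv X := ⟨ι⟩
  let _ : One X := ⟨x₀⟩
  let _ : CommGroup X := { Group.ofLeftAxioms hassoc hone hι with mul_comm := hcomm }
  have hmul : Continuous fun p : X × X => p.1 * p.2 := hμ
  have hrot : (fun g : X => f x₀ * g) = f := funext fun g => hact 1 g
  refine ⟨X, inferInstance, inferInstance,
    { continuous_mul := hmul, continuous_inv := continuous_inv_of_compactSpace hmul },
    inferInstance, inferInstance, f x₀, Homeomorph.refl X, ?_, fun x => (congrFun hrot x).symm⟩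
  rw [hrot]
  exact h

variable {X : Type u} [MetricSpace X] {f : X → X}

/-- The iterates lie in the family `p ↦ h.symm (g * h p)`, jointly continuous with `g` in the
compact `G`, hence equicontinuous. -/
theorem IsConjToMinimalRotation.isMinimalMap_and_isEquicontinuousMap [CompactSpace X]
    (h : IsConjToMinimalRotation f) : IsMinimalMap f ∧ IsEquicontinuousMap f := by
  obtain ⟨G, _, _, _, _, _, a, h, hmin, hconj⟩ := h
  have hsemi : Function.Semiconj h f (fun g => a * g) := hconj
  constructor
  · intro x
    have hd := (hmin (h x)).preimage h.isOpenMap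
    refine hd.mono ?_
    rintro y ⟨n, hn⟩
    exact ⟨n, h.injective (((hsemi.iterate_right n).eq x).trans hn)⟩
  · refine CompactSpace.uniformEquicontinuous_of_equicontinuous fun x => ?_
    intro U hU
    have hcont : Continuous (Function.uncurry fun (p : X) (g : G) => h.symm (g * h p)) :=
      h.symm.continuous.comp (continuous_snd.mul (h.continuous.comp continuous_fst))
    obtain ⟨v, hv, hvU⟩ := (isCompact_univ (X := G)).mem_uniformity_of_prod
      (s := Set.univ) (q := x) hcont.continuousOn (Set.mem_univ x)
      (tendsto_swap_uniformity hU)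
    rw [nhdsWithin_univ] at hv
    have hit : ∀ n y, f^[n] y = h.symm (a ^ n * h y) := fun n y => by
      rw [Homeomorph.eq_symm_apply, (hsemi.iterate_right n).eq y, mul_left_iterate]
    filter_upwards [hv] with y hy n
    rw [hit, hit]
    exact hvU y hy (a ^ n) (Set.mem_univ _)

end Conjugacy

end TopDyn

theorem theorem1p1 {X : Type u} [MetricSpace X] [CompactSpace X] [Infinite X]
    (f : X → X) (hf : Continuous f) :
    ((TopDyn.GluingOrbitProperty f ∧ TopDyn.topEntropy f = 0) ↔
      (TopDyn.IsMinimalMap f ∧ TopDyn.IsEquicontinuousMap f)) ∧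
    ((TopDyn.IsMinimalMap f ∧ TopDyn.IsEquicontinuousMap f) ↔
      TopDyn.IsConjToMinimalRotation f) := by
  refine ⟨⟨fun ⟨hg, h0⟩ => ?_,
      fun ⟨hm, he⟩ => ⟨hm.gluingOrbitProperty hf he, he.topEntropy_eq_zero⟩⟩,
    fun ⟨hm, he⟩ => hm.isConjToMinimalRotation hf he,
    fun h => h.isMinimalMap_and_isEquicontinuousMap⟩
  have he : TopDyn.IsEquicontinuousMap f :=
    CompactSpace.uniformEquicontinuous_of_equicontinuous
      (TopDyn.equicontinuous_iterate_of_card_le hf fun _ hε =>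
        hg.exists_card_le_of_topEntropy_eq_zero h0 hε)
  exact ⟨hg.isMinimalMap he, he⟩
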